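/- For $n\in\mathbb N$ let $M_n$ be the algebra of complex $n\times n$ matrices with its operator norm. For a linear map $\Psi\colon M_n\to M_m$ write $\|\Psi\|=\sup\{\|\Psi(x)\| : \|x\|\leqslant 1\}$, let $\Psi_k\colon M_k(M_n)\to M_k(M_m)$, $[x_{ij}]\mapsto[\Psi(x_{ij})]$, be its $k$-th amplification (where $M_k(M_n)=M_{kn}$ carries its operator norm), and let $\|\Psi\|_{cb}=\sup_{k\in\mathbb N}\|\Psi_k\|$ be its completely bounded norm. Proposition. Let $\Psi\colon M_n\to M_m$ be a linear map (no positivity is assumed). Then $$\|\Psi\|_{cb}\leqslant \min(m,n)\,\|\Psi\|.$$ -/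

import Mathlib

open scoped ENNReal Matrix.Norms.L2Operator

/-- The `k`-th amplification `Ψ_k = id_k ⊗ Ψ : M_k(M_n) → M_k(M_m)` of a linear map
`Ψ : M_n → M_m`: it applies `Ψ` to each entry of a `k × k` matrix of `n × n` matrices.
As usual, `M_k(M_n)` is identified with the matrices indexed by `Fin k × Fin n`, i.e. with
`M_{kn}`, which carries the operator norm of `ℂ^{kn}`. -/
def amplification {n m : ℕ} (k : ℕ)
    (Ψ : Matrix (Fin n) (Fin n) ℂ →ₗ[ℂ] Matrix (Fin m) (Fin m) ℂ) :
    Matrix (Fin k × Fin n) (Fin k × Fin n) ℂ →ₗ[ℂ]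
      Matrix (Fin k × Fin m) (Fin k × Fin m) ℂ :=
  (Matrix.compLinearEquiv (Fin k) (Fin k) (Fin m) (Fin m) ℂ ℂ).toLinearMap ∘ₗ
    Ψ.mapMatrix ∘ₗ
    (Matrix.compLinearEquiv (Fin k) (Fin k) (Fin n) (Fin n) ℂ ℂ).symm.toLinearMap

/-- The norm `‖T‖ = sup {‖T x‖ : ‖x‖ ≤ 1}` of a linear map between complex matrix algebras, each
with its operator norm (C⋆-norm). Such a map is automatically bounded, the spaces being
finite-dimensional. -/
noncomputable def matrixMapNorm {ι κ : Type*} [Fintype ι] [DecidableEq ι] [Fintype κ]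
    [DecidableEq κ] (T : Matrix ι ι ℂ →ₗ[ℂ] Matrix κ κ ℂ) : ℝ :=
  ‖LinearMap.toContinuousLinearMap T‖

/-- The completely bounded norm `‖Ψ‖_cb = sup_k ‖Ψ_k‖`, as an extended nonnegative real. -/
noncomputable def cbNorm {n m : ℕ}
    (Ψ : Matrix (Fin n) (Fin n) ℂ →ₗ[ℂ] Matrix (Fin m) (Fin m) ℂ) : ℝ≥0∞ :=
  ⨆ k : ℕ, ENNReal.ofReal (matrixMapNorm (amplification k Ψ))

/-! Both bounds estimate the bilinear form `v ⬝ᵥ Ψ_k(x) u`, uniformly in `k`. Factor `m`: slicing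
`v`, `u` into `v_p`, `u_q` in `ℂ^k` turns the form into the sum over `p, q` of the `(p, q)` entry of
`Ψ` at a compression of `x` of norm at most `‖x‖ ‖v_p‖ ‖u_q‖`; Cauchy–Schwarz over `p` and over `q`
costs `√m` each. Factor `n`: expanding in matrix units and applying Cauchy–Schwarz once separates
`x, v` from `Ψ, u`, at cost `√n` each. The `Ψ` side needs `∑ i j, ‖Ψ(e_ij) u‖² ≤ n ‖Ψ‖² ‖u‖²`: the
matrix units split into `n` permutation patterns, and on each one suitable signs reduce the sum to a
single value of `Ψ` on the unit ball. -/

section MatrixNormBounds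

variable {ι κ : Type*} [Fintype ι] [Fintype κ]

lemma sum_norm_sq_mulVec_le [DecidableEq κ] (A : Matrix ι κ ℂ) (u : κ → ℂ) :
    ∑ i, ‖(A.mulVec u) i‖ ^ 2 ≤ ‖A‖ ^ 2 * ∑ j, ‖u j‖ ^ 2 := by
  have h := Matrix.l2_opNorm_mulVec A (WithLp.toLp 2 u)
  have h2 := pow_le_pow_left₀ (norm_nonneg _) h 2
  rw [mul_pow, EuclideanSpace.norm_sq_eq, EuclideanSpace.norm_sq_eq] at h2
  exact h2

lemma sum_norm_sq_vecMul_le [DecidableEq ι] [DecidableEq κ] (A : Matrix ι κ ℂ) (v : ι → ℂ) :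
    ∑ j, ‖(Matrix.vecMul v A) j‖ ^ 2 ≤ ‖A‖ ^ 2 * ∑ i, ‖v i‖ ^ 2 := by
  have h := sum_norm_sq_mulVec_le A.conjTranspose (star v)
  rw [Matrix.l2_opNorm_conjTranspose, ← Matrix.star_vecMul] at h
  simpa using h

lemma norm_dotProduct_le (v w : ι → ℂ) :
    ‖v ⬝ᵥ w‖ ≤ √(∑ i, ‖v i‖ ^ 2) * √(∑ i, ‖w i‖ ^ 2) := by
  refine (norm_sum_le _ _).trans ?_
  simp only [norm_mul]
  exact Real.sum_mul_le_sqrt_mul_sqrt _ _ _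

lemma norm_dotProduct_mulVec_le [DecidableEq κ] (A : Matrix ι κ ℂ) (v : ι → ℂ) (u : κ → ℂ) :
    ‖v ⬝ᵥ A.mulVec u‖ ≤ ‖A‖ * (√(∑ i, ‖v i‖ ^ 2) * √(∑ j, ‖u j‖ ^ 2)) := by
  refine (norm_dotProduct_le _ _).trans ?_
  calc _ ≤ √(∑ i, ‖v i‖ ^ 2) * √(‖A‖ ^ 2 * ∑ j, ‖u j‖ ^ 2) := by
        gcongr; exact sum_norm_sq_mulVec_le A u
    _ = _ := by
        rw [Real.sqrt_mul (sq_nonneg _), Real.sqrt_sq (norm_nonneg _)]; ring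

lemma norm_le_of_sum_norm_sq_mulVec_le [DecidableEq κ] {A : Matrix ι κ ℂ} {C : ℝ} (hC : 0 ≤ C)
    (h : ∀ u : κ → ℂ, ∑ i, ‖(A.mulVec u) i‖ ^ 2 ≤ C ^ 2 * ∑ j, ‖u j‖ ^ 2) : ‖A‖ ≤ C := by
  rw [Matrix.l2_opNorm_def]
  refine ContinuousLinearMap.opNorm_le_bound _ hC fun u => ?_
  refine le_of_sq_le_sq ?_ (by positivity)
  rw [mul_pow, EuclideanSpace.norm_sq_eq, EuclideanSpace.norm_sq_eq]
  exact h u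

lemma norm_le_of_norm_dotProduct_mulVec_le [DecidableEq ι] [DecidableEq κ] {A : Matrix ι κ ℂ} {C : ℝ} (hC : 0 ≤ C)
    (h : ∀ v u, ‖v ⬝ᵥ A.mulVec u‖ ≤ C * (√(∑ i, ‖v i‖ ^ 2) * √(∑ j, ‖u j‖ ^ 2))) :
    ‖A‖ ≤ C := by
  refine norm_le_of_sum_norm_sq_mulVec_le hC fun u => ?_
  -- The form is bilinear, so the extremal test vector is the conjugate of `A u`.
  have h1 := h (star (A.mulVec u)) u
  set S := ∑ i, ‖(A.mulVec u) i‖ ^ 2 with hS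
  have hS0 : 0 ≤ S := by positivity
  have hU0 : 0 ≤ ∑ j, ‖u j‖ ^ 2 := by positivity
  have e1 : star (A.mulVec u) ⬝ᵥ A.mulVec u = (S : ℂ) := by
    simp [dotProduct, hS, Complex.conj_mul']
  have e2 : ∑ i, ‖(star (A.mulVec u)) i‖ ^ 2 = S := by simp [hS]
  rw [e1, e2, Complex.norm_real, Real.norm_of_nonneg hS0] at h1
  have hs := Real.mul_self_sqrt hS0
  have hu := Real.sq_sqrt hU0
  have h3 : √S ≤ C * √(∑ j, ‖u j‖ ^ 2) := by
    rcases (Real.sqrt_nonneg S).eq_or_lt with h0 | h0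
    · rw [← h0]; positivity
    · refine le_of_mul_le_mul_left ?_ h0
      rw [hs]; linarith
  calc S = √S ^ 2 := (Real.sq_sqrt hS0).symm
    _ ≤ (C * √(∑ j, ‖u j‖ ^ 2)) ^ 2 := by gcongr
    _ = _ := by rw [mul_pow, hu]

lemma norm_apply_le [DecidableEq ι] [DecidableEq κ] (A : Matrix ι κ ℂ) (i : ι) (j : κ) : ‖A i j‖ ≤ ‖A‖ := by
  simpa [Pi.single_apply, apply_ite] using
    norm_dotProduct_mulVec_le A (Pi.single i 1) (Pi.single j 1)

lemma matrixMapNorm_nonneg [DecidableEq ι] [DecidableEq κ] (T : Matrix ι ι ℂ →ₗ[ℂ] Matrix κ κ ℂ) : 0 ≤ matrixMapNorm T :=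
  norm_nonneg _

lemma norm_map_le [DecidableEq ι] [DecidableEq κ] (T : Matrix ι ι ℂ →ₗ[ℂ] Matrix κ κ ℂ) (x : Matrix ι ι ℂ) :
    ‖T x‖ ≤ matrixMapNorm T * ‖x‖ :=
  (LinearMap.toContinuousLinearMap T).le_opNorm x

lemma matrixMapNorm_le [DecidableEq ι] [DecidableEq κ] {T : Matrix ι ι ℂ →ₗ[ℂ] Matrix κ κ ℂ} {C : ℝ} (hC : 0 ≤ C)
    (h : ∀ x, ‖T x‖ ≤ C * ‖x‖) : matrixMapNorm T ≤ C :=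
  ContinuousLinearMap.opNorm_le_bound _ hC h

end MatrixNormBounds

/-- Signs can be chosen so that a signed sum is at least as long as if the vectors were
orthogonal. -/
lemma exists_unimodular_sum_norm_sq_le {ι E : Type*} [NormedAddCommGroup E]
    [InnerProductSpace ℂ E] (w : ι → E) (s : Finset ι) :
    ∃ ε : ι → ℂ, (∀ i, ‖ε i‖ = 1) ∧ ∑ i ∈ s, ‖w i‖ ^ 2 ≤ ‖∑ i ∈ s, ε i • w i‖ ^ 2 := by
  classical
  induction s using Finset.induction_on with
  | empty => exact ⟨fun _ => 1, by simp, by simp⟩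
  | insert a s ha ih =>
    obtain ⟨ε, hε, h⟩ := ih
    have key : ∀ c : ℂ, ∑ i ∈ s, Function.update ε a c i • w i = ∑ i ∈ s, ε i • w i := by
      intro c
      refine Finset.sum_congr rfl fun i hi => ?_
      rw [Function.update_of_ne (ne_of_mem_of_not_mem hi ha)]
    have upd : ∀ c : ℂ, ‖c‖ = 1 → ∀ i, ‖Function.update ε a c i‖ = 1 := by
      intro c hc i
      by_cases hi : i = a
      · subst hi; simpa using hc
      · simpa [Function.update_of_ne hi] using hε i
    -- The squared norms of sum and difference average to the sum of the two squared norms, so the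
    -- larger one suffices.
    have par := parallelogram_law_with_norm ℂ (∑ i ∈ s, ε i • w i) (w a)
    rcases le_total (‖∑ i ∈ s, ε i • w i - w a‖ ^ 2) (‖∑ i ∈ s, ε i • w i + w a‖ ^ 2) with hle | hle
    · refine ⟨Function.update ε a 1, upd 1 (by simp), ?_⟩
      rw [Finset.sum_insert ha, Finset.sum_insert ha, key, Function.update_self, one_smul,
        add_comm (w a)]
      linarith
    · refine ⟨Function.update ε a (-1), upd (-1) (by simp), ?_⟩
      rw [Finset.sum_insert ha, Finset.sum_insert ha, key, Function.update_self, neg_one_smul,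
        neg_add_eq_sub]
      linarith

/-- Such a matrix permutes coordinates and multiplies them by phases, hence is isometric. -/
lemma norm_sum_single_perm_le {ι : Type*} [Fintype ι] [DecidableEq ι] (σ : Equiv.Perm ι)
    (ε : ι → ℂ) (hε : ∀ i, ‖ε i‖ = 1) :
    ‖∑ i, ε i • Matrix.single i (σ i) (1 : ℂ)‖ ≤ 1 := by
  refine norm_le_of_sum_norm_sq_mulVec_le zero_le_one fun u => ?_
  have : ∀ i, ((∑ i, ε i • Matrix.single i (σ i) (1 : ℂ)).mulVec u) i = ε i * u (σ i) := by
    intro i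
    simp [Matrix.sum_mulVec, Matrix.single_mulVec, Finset.sum_apply,
      Function.update_apply]
  simp only [this, norm_mul, hε, one_mul, one_pow]
  exact (Equiv.sum_comp σ fun j => ‖u j‖ ^ 2).le

/-! ### Images of matrix units -/

section MatrixMaps

variable {n m : ℕ} (Ψ : Matrix (Fin n) (Fin n) ℂ →ₗ[ℂ] Matrix (Fin m) (Fin m) ℂ)

lemma sum_norm_sq_map_single_perm_mulVec_le (σ : Equiv.Perm (Fin n)) (u : Fin m → ℂ) :
    ∑ i, ∑ p, ‖((Ψ (Matrix.single i (σ i) 1)).mulVec u) p‖ ^ 2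
      ≤ matrixMapNorm Ψ ^ 2 * ∑ q, ‖u q‖ ^ 2 := by
  obtain ⟨ε, hε, h⟩ := exists_unimodular_sum_norm_sq_le
    (fun i => WithLp.toLp 2 ((Ψ (Matrix.single i (σ i) 1)).mulVec u)) Finset.univ
  simp only [EuclideanSpace.norm_sq_eq] at h
  refine h.trans ?_
  have e : ∀ p, (∑ i, ε i • WithLp.toLp 2 ((Ψ (Matrix.single i (σ i) 1)).mulVec u)).ofLp p
      = ((Ψ (∑ i, ε i • Matrix.single i (σ i) 1)).mulVec u) p := by
    intro p
    simp only [map_sum, map_smul, Matrix.sum_mulVec, Matrix.smul_mulVec, Finset.sum_apply,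
      WithLp.ofLp_sum, WithLp.ofLp_smul]
  simp only [e]
  refine (sum_norm_sq_mulVec_le _ _).trans ?_
  gcongr
  refine (norm_map_le _ _).trans ?_
  exact mul_le_of_le_one_right (matrixMapNorm_nonneg _) (norm_sum_single_perm_le σ ε hε)

lemma sum_norm_sq_map_single_mulVec_le (u : Fin m → ℂ) :
    ∑ i, ∑ j, ∑ p, ‖((Ψ (Matrix.single i j 1)).mulVec u) p‖ ^ 2
      ≤ n * (matrixMapNorm Ψ ^ 2 * ∑ q, ‖u q‖ ^ 2) := by
  rcases Nat.eq_zero_or_pos n with rfl | hn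
  · simp
  have : NeZero n := ⟨hn.ne'⟩
  -- Substituting `j = i + b` in the cyclic group `Fin n` partitions all pairs `(i, j)` into the
  -- graphs of the `n` shifts.
  calc ∑ i, ∑ j, ∑ p, ‖((Ψ (Matrix.single i j 1)).mulVec u) p‖ ^ 2
      = ∑ i, ∑ b, ∑ p, ‖((Ψ (Matrix.single i (Equiv.addRight b i) 1)).mulVec u) p‖ ^ 2 :=
        Finset.sum_congr rfl fun i _ =>
          (Equiv.sum_comp (Equiv.addLeft i)
            fun j => ∑ p, ‖((Ψ (Matrix.single i j 1)).mulVec u) p‖ ^ 2).symm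
    _ = ∑ b, ∑ i, ∑ p, ‖((Ψ (Matrix.single i (Equiv.addRight b i) 1)).mulVec u) p‖ ^ 2 :=
        Finset.sum_comm
    _ ≤ ∑ _b : Fin n, matrixMapNorm Ψ ^ 2 * ∑ q, ‖u q‖ ^ 2 :=
        Finset.sum_le_sum fun b _ => sum_norm_sq_map_single_perm_mulVec_le Ψ _ u
    _ = _ := by simp

/-! ### Compressions and the factor `m` -/

lemma amplification_apply (k : ℕ) (x : Matrix (Fin k × Fin n) (Fin k × Fin n) ℂ)
    (a b : Fin k × Fin m) :
    amplification k Ψ x a b = Ψ (fun i j => x (a.1, i) (b.1, j)) a.2 b.2 := rfl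

lemma map_apply_eq_sum (y : Matrix (Fin n) (Fin n) ℂ) (p q : Fin m) :
    Ψ y p q = ∑ i, ∑ j, y i j * Ψ (Matrix.single i j 1) p q := by
  conv_lhs => rw [Matrix.matrix_eq_sum_single y]
  simp only [map_sum, Matrix.sum_apply]
  refine Finset.sum_congr rfl fun i _ => Finset.sum_congr rfl fun j _ => ?_
  rw [show Matrix.single i j (y i j) = y i j • Matrix.single i j (1 : ℂ) by simp, map_smul]
  rfl

/-- The compression of `x` to `M_n` by the vectors `a`, `b` of `ℂ^k`. -/
def compression {k : ℕ} (x : Matrix (Fin k × Fin n) (Fin k × Fin n) ℂ) (a b : Fin k → ℂ) :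
    Matrix (Fin n) (Fin n) ℂ :=
  ∑ l, ∑ l', (a l * b l') • Matrix.of fun i j => x (l, i) (l', j)

/-- Testing the compression on `v`, `u` is testing `x` on `a ⊗ v`, `b ⊗ u`, and norms of elementary
tensors multiply. -/
lemma norm_compression_le {k : ℕ} (x : Matrix (Fin k × Fin n) (Fin k × Fin n) ℂ)
    (a b : Fin k → ℂ) :
    ‖compression x a b‖ ≤ ‖x‖ * (√(∑ l, ‖a l‖ ^ 2) * √(∑ l, ‖b l‖ ^ 2)) := by
  refine norm_le_of_norm_dotProduct_mulVec_le (by positivity) fun v u => ?_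
  have e : v ⬝ᵥ (compression x a b).mulVec u =
      (fun c : Fin k × Fin n => a c.1 * v c.2) ⬝ᵥ
        x.mulVec (fun c : Fin k × Fin n => b c.1 * u c.2) := by
    simp only [compression, dotProduct, Matrix.mulVec, Matrix.sum_apply, Matrix.smul_apply,
      Matrix.of_apply, smul_eq_mul, Finset.sum_mul, Finset.mul_sum, Fintype.sum_prod_type]
    rw [Finset.sum_comm (s := (Finset.univ : Finset (Fin k)))]
    refine Finset.sum_congr rfl fun i _ => ?_
    rw [Finset.sum_comm]
    refine Finset.sum_congr rfl fun l _ => ?_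
    rw [Finset.sum_comm]
    refine Finset.sum_congr rfl fun l' _ => Finset.sum_congr rfl fun j _ => ?_
    ring
  have s : ∀ (f : Fin k → ℂ) (g : Fin n → ℂ),
      ∑ c : Fin k × Fin n, ‖f c.1 * g c.2‖ ^ 2 = (∑ l, ‖f l‖ ^ 2) * ∑ i, ‖g i‖ ^ 2 := by
    intro f g
    simp only [norm_mul, mul_pow, Fintype.sum_prod_type, Finset.sum_mul_sum]
  rw [e]
  refine (norm_dotProduct_mulVec_le _ _ _).trans (le_of_eq ?_)
  rw [s, s, Real.sqrt_mul (by positivity), Real.sqrt_mul (by positivity)]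
  ring

lemma dotProduct_amplification_mulVec_eq_sum_compression {k : ℕ}
    (x : Matrix (Fin k × Fin n) (Fin k × Fin n) ℂ) (v u : Fin k × Fin m → ℂ) :
    v ⬝ᵥ (amplification k Ψ x).mulVec u =
      ∑ p, ∑ q, Ψ (compression x (fun l => v (l, p)) fun l => u (l, q)) p q := by
  simp only [compression, map_sum, map_smul, dotProduct, Matrix.mulVec, Matrix.sum_apply,
    Matrix.smul_apply, smul_eq_mul, Finset.mul_sum, Fintype.sum_prod_type, amplification_apply]
  rw [Finset.sum_comm]
  refine Finset.sum_congr rfl fun p _ => ?_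
  rw [Finset.sum_comm (s := (Finset.univ : Finset (Fin m)))]
  refine Finset.sum_congr rfl fun l _ => ?_
  rw [Finset.sum_comm]
  refine Finset.sum_congr rfl fun q _ => Finset.sum_congr rfl fun l' _ => ?_
  rw [mul_right_comm, mul_assoc]
  rfl

lemma sum_sqrt_le_sqrt_card_mul_sqrt (f : Fin m → ℝ) (hf : ∀ p, 0 ≤ f p) :
    ∑ p, √(f p) ≤ √m * √(∑ p, f p) := by
  simpa [Real.sq_sqrt, hf] using
    Real.sum_mul_le_sqrt_mul_sqrt Finset.univ (fun _ : Fin m => (1 : ℝ)) fun p => √(f p)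

lemma matrixMapNorm_amplification_le_codomain (k : ℕ) :
    matrixMapNorm (amplification k Ψ) ≤ m * matrixMapNorm Ψ := by
  have h0 := matrixMapNorm_nonneg Ψ
  refine matrixMapNorm_le (by positivity) fun x => ?_
  refine norm_le_of_norm_dotProduct_mulVec_le (by positivity) fun v u => ?_
  rw [dotProduct_amplification_mulVec_eq_sum_compression]
  set a : Fin m → ℝ := fun p => ∑ l, ‖v (l, p)‖ ^ 2 with ha
  set b : Fin m → ℝ := fun q => ∑ l, ‖u (l, q)‖ ^ 2 with hb
  have ea : ∑ c, ‖v c‖ ^ 2 = ∑ p, a p := Fintype.sum_prod_type_right _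
  have eb : ∑ c, ‖u c‖ ^ 2 = ∑ p, b p := Fintype.sum_prod_type_right _
  calc _ ≤ ∑ p, ∑ q, matrixMapNorm Ψ * (‖x‖ * (√(a p) * √(b q))) := by
        refine (norm_sum_le _ _).trans (Finset.sum_le_sum fun p _ =>
          (norm_sum_le _ _).trans (Finset.sum_le_sum fun q _ => ?_))
        refine (norm_apply_le _ _ _).trans ((norm_map_le _ _).trans ?_)
        gcongr
        exact norm_compression_le _ _ _
    _ = matrixMapNorm Ψ * ‖x‖ * ((∑ p, √(a p)) * ∑ q, √(b q)) := by
        rw [Finset.sum_mul_sum]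
        simp only [Finset.mul_sum, mul_assoc]
    _ ≤ matrixMapNorm Ψ * ‖x‖ * ((√m * √(∑ p, a p)) * (√m * √(∑ q, b q))) := by
        gcongr
        · exact sum_sqrt_le_sqrt_card_mul_sqrt a fun p => by positivity
        · exact sum_sqrt_le_sqrt_card_mul_sqrt b fun p => by positivity
    _ = _ := by
        rw [ea, eb]
        linear_combination (matrixMapNorm Ψ * ‖x‖ * √(∑ p, a p) * √(∑ q, b q)) *
          Real.mul_self_sqrt (Nat.cast_nonneg (α := ℝ) m)

/-! ### Matrix units and the factor `n` -/

/-- The `if` vector is `v_p ⊗ e_i`. With the joint index `((i, p), (l', j))`, the left vector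
depends only on `x, v` and the right one only on `Ψ, u`. -/
lemma dotProduct_amplification_mulVec_eq_dotProduct {k : ℕ}
    (x : Matrix (Fin k × Fin n) (Fin k × Fin n) ℂ) (v u : Fin k × Fin m → ℂ) :
    v ⬝ᵥ (amplification k Ψ x).mulVec u =
      (fun c : (Fin n × Fin m) × (Fin k × Fin n) => Matrix.vecMul
        (fun d : Fin k × Fin n => if d.2 = c.1.1 then v (d.1, c.1.2) else 0) x c.2) ⬝ᵥ
      (fun c => (Ψ (Matrix.single c.1.1 c.2.2 1)).mulVec (fun q => u (c.2.1, q)) c.1.2) := by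
  simp only [dotProduct, Matrix.mulVec, Matrix.vecMul, Fintype.sum_prod_type,
    amplification_apply, ite_mul, zero_mul, Finset.sum_ite_eq', Finset.mem_univ, if_true]
  simp only [map_apply_eq_sum Ψ (fun i j => x (_, i) (_, j)), Finset.sum_mul, Finset.mul_sum]
  rw [Finset.sum_comm, Finset.sum_comm (s := (Finset.univ : Finset (Fin n)))]
  refine Finset.sum_congr rfl fun p _ => ?_
  rw [Finset.sum_comm, Finset.sum_comm (s := (Finset.univ : Finset (Fin n)))]
  refine Finset.sum_congr rfl fun l' _ => ?_
  have h (F : Fin m → Fin n → Fin n → ℂ) :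
      ∑ q, ∑ i, ∑ j, F q i j = ∑ i, ∑ j, ∑ q, F q i j := by
    rw [Finset.sum_comm]
    exact Finset.sum_congr rfl fun i _ => Finset.sum_comm
  simp only [h]
  rw [Finset.sum_comm]
  refine Finset.sum_congr rfl fun i _ => ?_
  rw [Finset.sum_comm]
  refine Finset.sum_congr rfl fun j _ => ?_
  rw [Finset.sum_comm]
  refine Finset.sum_congr rfl fun l _ => Finset.sum_congr rfl fun q _ => ?_
  ring

/-- Each `v_p ⊗ e_i` has the norm of `v_p`, whatever `i` is; the `n` choices of `i` give the factor.
-/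
lemma sum_norm_sq_vecMul_slice_le {k : ℕ} (x : Matrix (Fin k × Fin n) (Fin k × Fin n) ℂ)
    (v : Fin k × Fin m → ℂ) :
    ∑ c : (Fin n × Fin m) × (Fin k × Fin n), ‖Matrix.vecMul
        (fun d : Fin k × Fin n => if d.2 = c.1.1 then v (d.1, c.1.2) else 0) x c.2‖ ^ 2
      ≤ n * (‖x‖ ^ 2 * ∑ c, ‖v c‖ ^ 2) := by
  have h (i : Fin n) (p : Fin m) :
      ∑ d : Fin k × Fin n, ‖if d.2 = i then v (d.1, p) else 0‖ ^ 2 = ∑ l, ‖v (l, p)‖ ^ 2 := by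
    simp [Fintype.sum_prod_type, apply_ite norm, ite_pow]
  rw [Fintype.sum_prod_type]
  calc _ ≤ ∑ c : Fin n × Fin m, ‖x‖ ^ 2 * ∑ l, ‖v (l, c.2)‖ ^ 2 :=
        Finset.sum_le_sum fun c _ => by
          rw [← h c.1 c.2]
          exact sum_norm_sq_vecMul_le x fun d => if d.2 = c.1 then v (d.1, c.2) else 0
    _ = _ := ?_
  rw [← Finset.mul_sum, Fintype.sum_prod_type]
  simp only [Finset.sum_const, Finset.card_univ, Fintype.card_fin, nsmul_eq_mul]
  rw [Fintype.sum_prod_type_right]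
  ring

lemma sum_norm_sq_map_single_mulVec_slice_le {k : ℕ} (u : Fin k × Fin m → ℂ) :
    ∑ c : (Fin n × Fin m) × (Fin k × Fin n),
        ‖(Ψ (Matrix.single c.1.1 c.2.2 1)).mulVec (fun q => u (c.2.1, q)) c.1.2‖ ^ 2
      ≤ n * (matrixMapNorm Ψ ^ 2 * ∑ c, ‖u c‖ ^ 2) := by
  calc _ = ∑ l, ∑ i, ∑ j, ∑ p,
        ‖((Ψ (Matrix.single i j 1)).mulVec fun q => u (l, q)) p‖ ^ 2 := by
        simp only [Fintype.sum_prod_type]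
        rw [Finset.sum_comm (s := (Finset.univ : Finset (Fin k)))]
        refine Finset.sum_congr rfl fun i _ => ?_
        rw [Finset.sum_comm]
        exact Finset.sum_congr rfl fun l _ => Finset.sum_comm
    _ ≤ ∑ l, n * (matrixMapNorm Ψ ^ 2 * ∑ q, ‖u (l, q)‖ ^ 2) :=
        Finset.sum_le_sum fun l _ => sum_norm_sq_map_single_mulVec_le Ψ _
    _ = _ := by simp only [Fintype.sum_prod_type, Finset.mul_sum]

lemma matrixMapNorm_amplification_le_domain (k : ℕ) :
    matrixMapNorm (amplification k Ψ) ≤ n * matrixMapNorm Ψ := by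
  have h0 := matrixMapNorm_nonneg Ψ
  refine matrixMapNorm_le (by positivity) fun x => ?_
  refine norm_le_of_norm_dotProduct_mulVec_le (by positivity) fun v u => ?_
  rw [dotProduct_amplification_mulVec_eq_dotProduct]
  refine (norm_dotProduct_le _ _).trans ((mul_le_mul
    (Real.sqrt_le_sqrt (sum_norm_sq_vecMul_slice_le x v))
    (Real.sqrt_le_sqrt (sum_norm_sq_map_single_mulVec_slice_le Ψ u))
    (Real.sqrt_nonneg _) (Real.sqrt_nonneg _)).trans (le_of_eq ?_))
  rw [Real.sqrt_mul (by positivity), Real.sqrt_mul (by positivity),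
    Real.sqrt_mul (by positivity), Real.sqrt_mul (by positivity),
    Real.sqrt_sq h0, Real.sqrt_sq (norm_nonneg x)]
  linear_combination (matrixMapNorm Ψ * ‖x‖ * √(∑ c, ‖v c‖ ^ 2) * √(∑ c, ‖u c‖ ^ 2)) *
    Real.mul_self_sqrt (Nat.cast_nonneg (α := ℝ) n)

end MatrixMaps

theorem mainTheorem5 (n m : ℕ)
    (Ψ : Matrix (Fin n) (Fin n) ℂ →ₗ[ℂ] Matrix (Fin m) (Fin m) ℂ) :
    cbNorm Ψ ≤ ENNReal.ofReal ((min m n : ℕ) * matrixMapNorm Ψ) := by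
  refine iSup_le fun k => ENNReal.ofReal_le_ofReal ?_
  rcases le_total m n with h | h
  · rw [min_eq_left h]
    exact matrixMapNorm_amplification_le_codomain Ψ k
  · rw [min_eq_right h]
    exact matrixMapNorm_amplification_le_domain Ψ k
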